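/- Let $H$ be a real Hilbert space, let $\varphi : H \to \mathbb{R}\cup\{+\infty\}$ be convex, lower semi-continuous and proper, with effective domain $D(\varphi)=\{x\in H : \varphi(x)<+\infty\}$ and subdifferential $\partial\varphi(x)=\{p\in H : \varphi(y)\ge \varphi(x)+\langle p,y-x\rangle \text{ for all } y\in H\}$. Let $A : D(A)\subset H\to H$ be a linear, not necessarily bounded, operator that is antisymmetric, i.e. $\langle Ax,y\rangle=-\langle x,Ay\rangle$ for all $x,y\in D(A)$ (when $D(A)$ is dense this means $D(A)\subset D(A^*)$ and $A^*=-A$ on $D(A)$), and suppose that $D(\varphi)\subset D(A)$. Let $x_0\in D(A)$ be such that $\partial\varphi(x_0)\neq\emptyset$. Then for every $\omega\in\mathbb{R}$ and every $T>0$ there exists $\bar u\in A^2_H([0,T])$, that is, an absolutely continuous arc $\bar u:[0,T]\to H$, differentiable almost everywhere, with $\dot{\bar u}\in L^2(0,T;H)$, such that $\bar u(0)=x_0$ and, for almost every $t\in[0,T]$, $\bar u(t)\in D(A)$ and $$-\dot{\bar u}(t)+A\bar u(t)-\omega\,\bar u(t)\in\partial\varphi(\bar u(t)).$$ -/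

import Mathlib

open MeasureTheory Set Filter Topology

namespace AsymFlow

/-- The effective domain `D(φ) = {x | φ(x) < +∞}` of an extended-real-valued function. -/
def effDomain {H : Type*} (φ : H → EReal) : Set H := {x | φ x < ⊤}

/-- A function is proper if it never takes the value `-∞` and is not identically `+∞`. -/
def IsProper {H : Type*} (φ : H → EReal) : Prop :=
  (∀ x, φ x ≠ ⊥) ∧ (effDomain φ).Nonempty

/-- An extended-real-valued function is convex if its epigraph is a convex set. -/
def IsConvex {H : Type*} [AddCommGroup H] [Module ℝ H] (φ : H → EReal) : Prop :=
  Convex ℝ {p : H × ℝ | φ p.1 ≤ (p.2 : EReal)}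

/-- The subdifferential `∂φ(x)`: all `p` with `φ(y) ≥ φ(x) + ⟨p, y - x⟩` for every `y`. -/
def subdiff {H : Type*} [NormedAddCommGroup H] [InnerProductSpace ℝ H]
    (φ : H → EReal) (x : H) : Set H :=
  {p | ∀ y, φ x + ((inner ℝ p (y - x) : ℝ) : EReal) ≤ φ y}

/-- An (in general unbounded) linear operator `A : D(A) ⊆ H → H` is antisymmetric if
`⟨A x, y⟩ = -⟨x, A y⟩` for all `x, y ∈ D(A)`.  For a densely defined operator this says that
`D(A) ⊆ D(A*)` and `A* = -A` on `D(A)`, see `isAntisymmetric_iff_neg_le_adjoint`. -/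
def IsAntisymmetric {H : Type*} [NormedAddCommGroup H] [InnerProductSpace ℝ H]
    (A : H →ₗ.[ℝ] H) : Prop :=
  ∀ x y : A.domain, inner ℝ (A x) (y : H) = -inner ℝ (x : H) (A y)

theorem isAntisymmetric_iff_neg_le_adjoint {H : Type*} [NormedAddCommGroup H]
    [InnerProductSpace ℝ H] [CompleteSpace H] (A : H →ₗ.[ℝ] H)
    (hA : Dense (A.domain : Set H)) :
    IsAntisymmetric A ↔ -A ≤ A.adjoint := by
  constructor
  · intro h
    refine LinearPMap.IsFormalAdjoint.le_adjoint hA ?_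
    intro x y
    rw [LinearPMap.neg_apply, inner_neg_right]
    exact h x y
  · intro h x y
    have hx : (x : H) ∈ A.adjoint.domain := h.1 x.2
    have h1 : (-A) x = A.adjoint ⟨x, hx⟩ := h.2 rfl
    have h2 := LinearPMap.adjoint_isFormalAdjoint hA ⟨x, hx⟩ y
    rw [← h1, LinearPMap.neg_apply, inner_neg_left] at h2
    simpa using congrArg Neg.neg h2

/-- The path space `A²_H([0,T])`: absolutely continuous arcs `u : [0,T] → H` whose a.e.
derivative belongs to `L²(0,T;H)`.  Arcs are represented by functions on `ℝ`, of which only the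
restriction to `[0,T]` matters. -/
structure MemPathSpace {H : Type*} [NormedAddCommGroup H] [InnerProductSpace ℝ H]
    (T : ℝ) (u : ℝ → H) : Prop where
  absolutelyContinuous : AbsolutelyContinuousOnInterval u 0 T
  ae_differentiable : ∀ᵐ t ∂(volume.restrict (Icc 0 T)), DifferentiableAt ℝ u t
  memLp_deriv : MemLp (deriv u) 2 (volume.restrict (Icc 0 T))

end AsymFlow

/-! Put `G x p` for `p + A x ∈ ∂φ x`, the graph of `∂φ - A`. Since `⟨A z, z⟩ = 0`, this relation is
monotone, and the flow sought is `-u' - ω u ∈ (∂φ - A) u`.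

The main difficulty is that the resolvent is everywhere defined, with `A` neither bounded nor
assumed closed. The resolvent equation is recast as a family of inequalities in `x`, one for each
test point `z ∈ D(φ)`, in which `A` acts only on `z`. Each inequality cuts out a closed convex set.
Finitely many of them are solved at once by a skew-symmetric matrix game of value zero, and all of
them by weak compactness (`exists_forall_le_of_antisymmetric`, `exists_resolvent_mem_subdiff`).

The rest is Kōmura–Brezis theory. Yosida approximations give Lipschitz ODEs with bounds uniform in
the parameter. Their solutions converge pointwise to a Lipschitz curve, which is a primitive of a
weak `L²` limit. Wherever this curve is differentiable, a dissipation inequality against every pair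
of `G` and the maximality of `G` give the inclusion (`exists_evolution_of_monotone`). -/

namespace AsymFlow

/-! ### Skew games and weak compactness of convex sets -/

/-- A skew-symmetric matrix game has value zero: some mixed strategy makes every payoff
nonpositive. -/
theorem exists_mem_stdSimplex_sum_nonpos {ι : Type*} [Fintype ι] [Nonempty ι]
    (M : Matrix ι ι ℝ) (hM : ∀ i j, M i j = -M j i) :
    ∃ w ∈ stdSimplex ℝ ι, ∀ i, ∑ j, w j * M j i ≤ 0 := by
  classical
  have hne : (stdSimplex ℝ ι).Nonempty := ⟨_, single_mem_stdSimplex ℝ (Classical.arbitrary ι)⟩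
  have hconv : Convex ℝ (stdSimplex ℝ ι) := convex_stdSimplex ℝ ι
  have hcpt : IsCompact (stdSimplex ℝ ι) := isCompact_stdSimplex ℝ ι
  have hcont : Continuous fun p : (ι → ℝ) × (ι → ℝ) ↦ (Matrix.vecMul p.1 M) ⬝ᵥ p.2 := by
    fun_prop
  obtain ⟨a, ha, b, hb, hab⟩ := Sion.exists_isSaddlePointOn (f := fun x y : ι → ℝ ↦
      (Matrix.vecMul x M) ⬝ᵥ y) hne hconv hcpt
    (fun y _ ↦ (Continuous.lowerSemicontinuous (by fun_prop)).lowerSemicontinuousOn _)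
    (fun y _ ↦ ConvexOn.quasiconvexOn ⟨hconv, fun x₁ _ x₂ _ s t _ _ _ ↦ by
      simp [Matrix.add_vecMul, Matrix.smul_vecMul, add_dotProduct, smul_dotProduct]⟩)
    hconv hne hcpt
    (fun x _ ↦ (Continuous.upperSemicontinuous (by fun_prop)).upperSemicontinuousOn _)
    (fun x _ ↦ ConcaveOn.quasiconcaveOn ⟨hconv, fun y₁ _ y₂ _ s t _ _ _ ↦ by
      simp [dotProduct_add, dotProduct_smul]⟩)
  refine ⟨a, ha, fun i ↦ ?_⟩
  -- Letting the first player copy `b` bounds the saddle value by `bᵀ M b`, which skewness makes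
  -- zero.
  have hbb : (Matrix.vecMul b M) ⬝ᵥ b = 0 := by
    have htr : M.transpose = -M := by
      ext i j
      simp [hM j i]
    have h1 : (Matrix.vecMul b M) ⬝ᵥ b = -((Matrix.vecMul b M) ⬝ᵥ b) := by
      conv_lhs => rw [dotProduct_comm, ← Matrix.mulVec_transpose, htr, Matrix.neg_mulVec,
        dotProduct_neg, Matrix.dotProduct_mulVec]
    linarith
  have h := hab b hb _ (single_mem_stdSimplex ℝ i)
  simp only [hbb, dotProduct_single, mul_one] at h
  simpa [Matrix.vecMul, dotProduct] using h

/-- Closed convex subsets of a Hilbert space, one of which is bounded, have a common point as soon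
as finitely many of them always do. -/
theorem nonempty_iInter_of_closed_convex {E ι : Type*} [NormedAddCommGroup E]
    [InnerProductSpace ℝ E] [CompleteSpace E] (C : ι → Set E) (hclosed : ∀ i, IsClosed (C i))
    (hconv : ∀ i, Convex ℝ (C i)) (i₀ : ι) (hb : Bornology.IsBounded (C i₀))
    (hfin : ∀ F : Finset ι, (⋂ i ∈ F, C i).Nonempty) : (⋂ i, C i).Nonempty := by
  classical
  -- Points of minimal norm in the finite intersections: their squared norms increase with `F` and
  -- are bounded thanks to `i₀`, so this projection inequality makes the net Cauchy.
  have key : ∀ F : Finset ι, ∃ v ∈ ⋂ i ∈ insert i₀ F, C i, ∀ w ∈ ⋂ i ∈ insert i₀ F, C i,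
      ‖v‖ ^ 2 + ‖w - v‖ ^ 2 ≤ ‖w‖ ^ 2 := by
    intro F
    have hc : Convex ℝ (⋂ i ∈ insert i₀ F, C i) := convex_iInter₂ fun i _ ↦ hconv i
    have hcl : IsClosed (⋂ i ∈ insert i₀ F, C i) := isClosed_biInter fun i _ ↦ hclosed i
    obtain ⟨v, hv, hmin⟩ := exists_norm_eq_iInf_of_complete_convex (hfin _) hcl.isComplete hc 0
    refine ⟨v, hv, fun w hw ↦ ?_⟩
    have h := (norm_eq_iInf_iff_real_inner_le_zero hc hv).1 hmin w hw
    have h2 := norm_add_sq_real v (w - v)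
    rw [add_sub_cancel] at h2
    rw [zero_sub, inner_neg_left] at h
    linarith
  choose x hx hmin using key
  obtain ⟨R, hR⟩ := hb.exists_norm_le
  have hbdd : BddAbove (range fun F ↦ ‖x F‖ ^ 2) := by
    refine ⟨R ^ 2, ?_⟩
    rintro _ ⟨F, rfl⟩
    exact pow_le_pow_left₀ (norm_nonneg _)
      (hR _ (mem_iInter₂.1 (hx F) i₀ (Finset.mem_insert_self _ _))) 2
  have hcauchy : CauchySeq x := by
    refine Metric.cauchySeq_iff'.2 fun ε hε ↦ ?_
    obtain ⟨N, hN⟩ := exists_lt_of_lt_ciSup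
      (show (⨆ F, ‖x F‖ ^ 2) - ε ^ 2 < ⨆ F, ‖x F‖ ^ 2 by nlinarith [pow_pos hε 2])
    refine ⟨N, fun F hF ↦ ?_⟩
    have h1 : x F ∈ ⋂ i ∈ insert i₀ N, C i :=
      biInter_subset_biInter_left (fun i hi ↦ Finset.insert_subset_insert i₀ hF hi) (hx F)
    have h2 := hmin N _ h1
    have h3 := le_ciSup hbdd F
    rw [dist_eq_norm]
    refine lt_of_pow_lt_pow_left₀ 2 hε.le ?_
    linarith
  obtain ⟨v, hv⟩ := cauchySeq_tendsto_of_complete hcauchy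
  refine ⟨v, mem_iInter.2 fun i ↦ (hclosed i).mem_of_tendsto hv ?_⟩
  filter_upwards [eventually_ge_atTop {i}] with F hF
  exact mem_iInter₂.1 (hx F) i (Finset.mem_insert_of_mem (hF (Finset.mem_singleton_self i)))

/-! ### Subgradients and convexity -/

variable {H : Type*} [NormedAddCommGroup H] [InnerProductSpace ℝ H]

theorem coe_toReal_of_mem_effDomain {X : Type*} {φ : X → EReal} (hproper : IsProper φ) {x : X}
    (hx : x ∈ effDomain φ) : ((φ x).toReal : EReal) = φ x :=
  EReal.coe_toReal (ne_of_lt hx) (hproper.1 x)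

theorem mem_effDomain_of_mem_subdiff {φ : H → EReal} (hproper : IsProper φ) {x p : H}
    (hp : p ∈ subdiff φ x) : x ∈ effDomain φ := by
  obtain ⟨z, hz⟩ := hproper.2
  refine lt_of_le_of_ne (le_top : φ x ≤ ⊤) fun htop ↦ ?_
  have h := hp z
  rw [htop, EReal.top_add_coe, top_le_iff] at h
  exact hz.ne h

theorem toReal_add_inner_le {φ : H → EReal} (hproper : IsProper φ) {x p : H}
    (hp : p ∈ subdiff φ x) {z : H} (hz : z ∈ effDomain φ) :
    (φ x).toReal + inner ℝ p (z - x) ≤ (φ z).toReal := by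
  have h := hp z
  rw [← coe_toReal_of_mem_effDomain hproper hz,
    ← coe_toReal_of_mem_effDomain hproper (mem_effDomain_of_mem_subdiff hproper hp)] at h
  exact_mod_cast h

theorem IsAntisymmetric.inner_self {A : H →ₗ.[ℝ] H} (hA : IsAntisymmetric A) (x : A.domain) :
    inner ℝ (A x) (x : H) = 0 := by
  have h := hA x x
  rw [real_inner_comm] at h
  rw [real_inner_comm]
  linarith

/-- A subgradient inequality up to a quadratic error is a subgradient inequality. -/
theorem mem_subdiff_of_quadratic_error {φ : H → EReal} (hconv : IsConvex φ)
    (hproper : IsProper φ) {x q : H} (hx : x ∈ effDomain φ) {c : ℝ} (hc : 0 ≤ c)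
    (h : ∀ z ∈ effDomain φ,
      (φ x).toReal + inner ℝ q (z - x) - c * ‖z - x‖ ^ 2 ≤ (φ z).toReal) :
    q ∈ subdiff φ x := by
  intro z
  by_cases hz : z ∈ effDomain φ
  swap
  · have : φ z = ⊤ := by simpa [effDomain] using hz
    rw [this]
    exact le_top
  have hxr := coe_toReal_of_mem_effDomain hproper hx
  have hzr := coe_toReal_of_mem_effDomain hproper hz
  rw [← hxr, ← hzr]
  suffices hs : (φ x).toReal + inner ℝ q (z - x) ≤ (φ z).toReal by exact_mod_cast hs
  refine le_of_forall_pos_le_add fun ε hε ↦ ?_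
  set d := c * ‖z - x‖ ^ 2 with hd
  have hd0 : 0 ≤ d := by positivity
  -- Moving only a fraction `t` towards `z` scales the linear terms by `t` but the error by `t ^ 2`;
  -- after division by `t` the error is `t * d ≤ ε`.
  set t := min 1 (ε / (d + 1)) with ht
  have ht0 : 0 < t := lt_min one_pos (by positivity)
  have ht1 : t ≤ 1 := min_le_left _ _
  have htd : t * d ≤ ε := by
    have h1 : t * (d + 1) ≤ ε := (le_div_iff₀ (by positivity)).1 (min_le_right _ _)
    nlinarith
  have hmem := hconv (x := (x, (φ x).toReal)) (y := (z, (φ z).toReal)) hxr.ge hzr.ge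
    (sub_nonneg.2 ht1) ht0.le (by ring)
  simp only [Prod.smul_mk, Prod.mk_add_mk, mem_ofPred_eq, smul_eq_mul] at hmem
  set w := (1 - t) • x + t • z with hw
  have hwD : w ∈ effDomain φ := lt_of_le_of_lt hmem (EReal.coe_lt_top _)
  have hwx : w - x = t • (z - x) := by rw [hw]; module
  have h1 := h w hwD
  rw [← coe_toReal_of_mem_effDomain hproper hwD, EReal.coe_le_coe_iff] at hmem
  rw [hwx, inner_smul_right, norm_smul, mul_pow, Real.norm_eq_abs, sq_abs] at h1
  have h2 : t * (inner ℝ q (z - x) - t * d) ≤ t * ((φ z).toReal - (φ x).toReal) := by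
    rw [hd]
    nlinarith
  have h3 := le_of_mul_le_mul_left h2 ht0
  linarith

/-- The squared norm of a convex combination is at most the combination of the squared norms. -/
theorem norm_sq_sum_smul_le {E ι : Type*} [NormedAddCommGroup E] [InnerProductSpace ℝ E]
    (s : Finset ι) (w : ι → ℝ) (hw : ∀ i ∈ s, 0 ≤ w i) (hw1 : ∑ i ∈ s, w i = 1) (z : ι → E) :
    ‖∑ i ∈ s, w i • z i‖ ^ 2 ≤ ∑ i ∈ s, w i * ‖z i‖ ^ 2 := by
  have h : ConvexOn ℝ univ fun x : E ↦ ‖x‖ ^ 2 :=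
    convexOn_univ_norm.pow (fun x _ ↦ norm_nonneg x) 2
  simpa using h.map_sum_le hw hw1 (fun i _ ↦ mem_univ (z i))

/-- A chord of the graph of `c` with endpoints in the epigraph of `φ` stays in that epigraph, and
concavity puts `c` above the chord. -/
theorem convex_setOf_le_concave {H : Type*} [NormedAddCommGroup H] [InnerProductSpace ℝ H]
    {φ : H → EReal} (hconv : IsConvex φ) {c : H → ℝ} (hc : ConcaveOn ℝ univ c) :
    Convex ℝ {x | φ x ≤ (c x : EReal)} := by
  intro x hx y hy s t hs ht hst
  have h := hconv (x := (x, c x)) (y := (y, c y)) hx hy hs ht hst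
  simp only [Prod.smul_mk, Prod.mk_add_mk, mem_ofPred_eq] at h
  exact h.trans (EReal.coe_le_coe_iff.2 (hc.2 trivial trivial hs ht hst))

/-! ### Resolvents of `∂φ - A` -/

/-- The convex program behind the resolvent: the Ky Fan type inequality for the operator
`∂φ - A`, obtained from the skew-symmetry of `A`. -/
theorem exists_forall_le_of_antisymmetric {H : Type*} [NormedAddCommGroup H]
    [InnerProductSpace ℝ H] [CompleteSpace H]
    (φ : H → EReal) (hconv : IsConvex φ) (hlsc : LowerSemicontinuous φ)
    (hproper : IsProper φ) (A : H →ₗ.[ℝ] H) (hA : IsAntisymmetric A)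
    (hdom : effDomain φ ⊆ (A.domain : Set H)) {x₀ p₀ : H} (hp₀ : p₀ ∈ subdiff φ x₀)
    {a : ℝ} (ha : 0 < a) (v : H) :
    ∃ x, ∀ z (hz : z ∈ effDomain φ), φ x ≤ (((φ z).toReal + a * ‖z‖ ^ 2 - inner ℝ v z
      + inner ℝ x (A ⟨z, hdom hz⟩) - a * ‖x‖ ^ 2 + inner ℝ v x : ℝ) : EReal) := by
  classical
  have hx₀ := mem_effDomain_of_mem_subdiff hproper hp₀
  set c : effDomain φ → H → ℝ := fun z x ↦ (φ z).toReal + a * ‖(z : H)‖ ^ 2 - inner ℝ v (z : H)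
      + inner ℝ x (A ⟨z, hdom z.2⟩) - a * ‖x‖ ^ 2 + inner ℝ v x with hc
  have hccont : ∀ z, Continuous (c z) := fun z ↦ by
    simp only [hc]
    fun_prop
  have hcconc : ∀ z, ConcaveOn ℝ univ (c z) := by
    intro z
    refine ⟨convex_univ, fun x _ y _ s t hs ht hst ↦ ?_⟩
    have h : ConvexOn ℝ univ fun x : H ↦ ‖x‖ ^ 2 :=
      convexOn_univ_norm.pow (fun x _ ↦ norm_nonneg x) 2
    have h1 := h.2 (mem_univ x) (mem_univ y) hs ht hst
    have h2 := mul_le_mul_of_nonneg_left h1 ha.le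
    obtain rfl : s = 1 - t := by linarith
    simp only [hc, inner_add_left, inner_add_right, inner_smul_left, inner_smul_right,
      smul_eq_mul, conj_trivial] at h2 ⊢
    linarith
  have hne : (⋂ z, {x | φ x ≤ (c z x : EReal)}).Nonempty := by
    refine nonempty_iInter_of_closed_convex _ (fun z ↦ ?_)
      (fun z ↦ convex_setOf_le_concave hconv (hcconc z)) ⟨x₀, hx₀⟩ ?_ fun F ↦ ?_
    · exact hlsc.isClosed_epigraph.preimage (f := fun x ↦ (x, (c z x : EReal)))
        (continuous_id.prodMk (continuous_coe_real_ereal.comp (hccont z)))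
    -- The subgradient `p₀` gives an affine minorant of `φ`, so membership in the set of `x₀` forces
    -- `a * ‖x‖ ^ 2 ≤ d + ⟨b, x⟩`. The `+ 1` in the radius makes `‖x‖ > 1` outside the ball, which
    -- absorbs `|d|` into `|d| * ‖x‖`.
    · set b := A ⟨x₀, hdom hx₀⟩ + v - p₀ with hb
      set d := a * ‖x₀‖ ^ 2 - inner ℝ v x₀ + inner ℝ p₀ x₀ with hd
      refine (Metric.isBounded_closedBall (x := (0 : H)) (r := (‖b‖ + |d|) / a + 1)).subset ?_
      intro x hx
      have h1 := (hp₀ x).trans hx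
      rw [← coe_toReal_of_mem_effDomain hproper hx₀] at h1
      have h2 : (φ x₀).toReal + inner ℝ p₀ (x - x₀) ≤ c ⟨x₀, hx₀⟩ x := by exact_mod_cast h1
      have h3 : a * ‖x‖ ^ 2 ≤ d + inner ℝ b x := by
        simp only [hc, hd, hb, inner_sub_right, inner_sub_left, inner_add_left] at h2 ⊢
        have hcomm := real_inner_comm x (A ⟨x₀, hdom hx₀⟩)
        linarith
      have h4 : a * ‖x‖ ^ 2 ≤ |d| + ‖b‖ * ‖x‖ :=
        h3.trans (add_le_add (le_abs_self d) (real_inner_le_norm b x))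
      rw [mem_closedBall_zero_iff]
      by_contra! hlt
      have h5 : ‖b‖ + |d| < a * ‖x‖ := by
        have : (‖b‖ + |d|) / a < ‖x‖ := by linarith
        rw [div_lt_iff₀ ha] at this
        linarith
      have h6 : 1 < ‖x‖ := by
        have : 0 ≤ (‖b‖ + |d|) / a := by positivity
        linarith
      nlinarith [abs_nonneg d, norm_nonneg b]
    · rcases F.eq_empty_or_nonempty with rfl | hF
      · exact ⟨0, by simp⟩
      have : Nonempty F := hF.to_subtype
      set r : effDomain φ → ℝ := fun z ↦ (φ z).toReal + a * ‖(z : H)‖ ^ 2 - inner ℝ v (z : H)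
        with hr
      -- Antisymmetry of `A` makes this matrix skew. The barycentre of the test points under an
      -- optimal strategy solves all inequalities of `F`, by convexity of `φ` and of the squared
      -- norm.
      set M : Matrix F F ℝ := fun j i ↦ r j - r i -
        inner ℝ ((j : effDomain φ) : H) (A ⟨i, hdom i.1.2⟩) with hM
      obtain ⟨w, hw, hwM⟩ := exists_mem_stdSimplex_sum_nonpos M (fun i j ↦ by
        have h := hA ⟨i, hdom i.1.2⟩ ⟨j, hdom j.1.2⟩
        rw [real_inner_comm] at h
        simp only [hM]
        linarith)
      refine ⟨∑ j, w j • ((j : effDomain φ) : H), mem_iInter₂.2 fun i hi ↦ ?_⟩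
      set x : H := ∑ j, w j • ((j : effDomain φ) : H) with hx
      have hepi : φ x ≤ ((∑ j, w j * (φ (j : effDomain φ)).toReal : ℝ) : EReal) := by
        have h := Convex.sum_mem hconv (t := Finset.univ) (w := w)
          (z := fun j : F ↦ (((j : effDomain φ) : H), (φ (j : effDomain φ)).toReal))
          (fun j _ ↦ hw.1 j) hw.2
          (fun j _ ↦ (coe_toReal_of_mem_effDomain hproper j.1.2).ge)
        simpa only [mem_ofPred_eq, Prod.fst_sum, Prod.snd_sum, Prod.smul_fst, Prod.smul_snd,
          smul_eq_mul, ← hx] using h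
      refine hepi.trans (EReal.coe_le_coe_iff.2 ?_)
      have h1 := hwM ⟨i, hi⟩
      have h2 : ∑ j, w j * M j ⟨i, hi⟩ = ∑ j, w j * (φ (j : effDomain φ)).toReal
          + a * ∑ j, w j * ‖((j : effDomain φ) : H)‖ ^ 2 - inner ℝ v x - r i
          - inner ℝ x (A ⟨i, hdom i.2⟩) := by
        have h3 : ∑ j, w j * r i = r i := by rw [← Finset.sum_mul, hw.2, one_mul]
        simp only [hx, inner_sum, sum_inner, inner_smul_left, inner_smul_right, conj_trivial]
        conv_rhs => rw [← h3]
        rw [Finset.mul_sum, ← Finset.sum_add_distrib, ← Finset.sum_sub_distrib,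
          ← Finset.sum_sub_distrib, ← Finset.sum_sub_distrib]
        refine Finset.sum_congr rfl fun j _ ↦ ?_
        simp only [hM]
        rw [show r j = (φ (j : effDomain φ)).toReal + a * ‖((j : effDomain φ) : H)‖ ^ 2
          - inner ℝ v ((j : effDomain φ) : H) from rfl]
        ring
      have h4 := mul_le_mul_of_nonneg_left (norm_sq_sum_smul_le Finset.univ w
        (fun j _ ↦ hw.1 j) hw.2 (fun j : F ↦ ((j : effDomain φ) : H))) ha.le
      rw [← hx] at h4
      have h5 : c i x = r i + inner ℝ x (A ⟨i, hdom i.2⟩) - a * ‖x‖ ^ 2 + inner ℝ v x := rfl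
      linarith
  obtain ⟨x, hx⟩ := hne
  exact ⟨x, fun z hz ↦ mem_iInter.1 hx ⟨z, hz⟩⟩

/-- The range condition for the operator `∂φ - A`: its resolvents are everywhere defined. -/
theorem exists_resolvent_mem_subdiff {H : Type*} [NormedAddCommGroup H]
    [InnerProductSpace ℝ H] [CompleteSpace H]
    (φ : H → EReal) (hconv : IsConvex φ) (hlsc : LowerSemicontinuous φ)
    (hproper : IsProper φ) (A : H →ₗ.[ℝ] H) (hA : IsAntisymmetric A)
    (hdom : effDomain φ ⊆ (A.domain : Set H)) (hsub : ∃ x₀, (subdiff φ x₀).Nonempty)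
    {lam : ℝ} (hlam : 0 < lam) (y : H) :
    ∃ x, ∃ hx : x ∈ A.domain, lam⁻¹ • (y - x) + A ⟨x, hx⟩ ∈ subdiff φ x := by
  obtain ⟨x₀, p₀, hp₀⟩ := hsub
  have ha : 0 < lam⁻¹ / 2 := by positivity
  obtain ⟨x, hx⟩ := exists_forall_le_of_antisymmetric φ hconv hlsc hproper A hA hdom hp₀ ha
    (lam⁻¹ • y)
  have hxD : x ∈ effDomain φ :=
    lt_of_le_of_lt (hx x₀ (mem_effDomain_of_mem_subdiff hproper hp₀)) (EReal.coe_lt_top _)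
  -- Now that `x ∈ D(φ) ⊆ D(A)`, `⟨x, A z⟩` becomes `-⟨A x, z - x⟩`, and expanding `‖z‖ ^ 2` around
  -- `x` leaves exactly the error `‖z - x‖ ^ 2 / (2 * lam)`.
  refine ⟨x, hdom hxD, mem_subdiff_of_quadratic_error hconv hproper hxD ha.le fun z hz ↦ ?_⟩
  have h := hx z hz
  rw [← coe_toReal_of_mem_effDomain hproper hxD, EReal.coe_le_coe_iff] at h
  have h1 := hA ⟨x, hdom hxD⟩ ⟨z, hdom hz⟩
  have h2 := hA.inner_self ⟨x, hdom hxD⟩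
  have h3 := norm_sub_sq_real z x
  simp only at h1 h2
  have h4 := real_inner_self_eq_norm_sq x
  have h5 := real_inner_comm z x
  simp only [inner_add_left, inner_sub_left, inner_sub_right, inner_smul_left, conj_trivial]
    at h h3 ⊢
  rw [h3, h2, h4]
  rw [h5]
  linarith

/-! ### Lipschitz ODEs and Gronwall estimates -/

theorem abs_max_min_sub_le (p q : ℝ) :
    |max 0 (min 1 p) - max 0 (min 1 q)| ≤ |p - q| := by
  have h1 := abs_max_sub_max_le_max 0 (min 1 p) 0 (min 1 q)
  have h2 := abs_min_sub_min_le_max 1 p 1 q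
  simp only [sub_self, abs_zero, abs_nonneg, max_eq_right] at h1 h2
  exact h1.trans h2

/-- Global existence for autonomous Lipschitz vector fields on a Banach space. -/
theorem exists_hasDerivAt_of_lipschitzWith {E : Type*} [NormedAddCommGroup E] [NormedSpace ℝ E]
    [CompleteSpace E] {f : E → E} {K : NNReal} (hf : LipschitzWith K f) (x₀ : E) {T : ℝ}
    (hT : 0 < T) : ∃ u : ℝ → E, u 0 = x₀ ∧ ∀ t ∈ Icc 0 T, HasDerivAt u (f (u t)) t := by
  set C : NNReal := ‖f x₀‖₊ with hC
  have hgrow : ∀ x, ‖f x‖ ≤ K * ‖x - x₀‖ + C := fun x ↦ by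
    have h1 := hf.norm_sub_le x x₀
    have h2 := norm_le_norm_add_norm_sub' (f x) (f x₀)
    have h3 : (C : ℝ) = ‖f x₀‖ := rfl
    linarith
  obtain ⟨r, hr0, hr⟩ : ∃ r : NNReal, 0 < r ∧ gronwallBound 0 K C T ≤ r :=
    ⟨Real.toNNReal (gronwallBound 0 K C T) + 1, by positivity, by
      have := Real.le_coe_toNNReal (gronwallBound 0 K C T)
      push_cast
      linarith⟩
  -- The cutoff is `1` within distance `r` of `x₀` and `0` beyond `2 * r`. The truncated field is
  -- bounded, so Picard–Lindelöf reaches any time.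
  set cut : E → ℝ := fun x ↦ max 0 (min 1 (2 - (r : ℝ)⁻¹ * ‖x - x₀‖)) with hcut
  have hcut0 : ∀ x, 0 ≤ cut x := fun x ↦ le_max_left _ _
  have hcut1 : ∀ x, cut x ≤ 1 := fun x ↦ max_le zero_le_one (min_le_left _ _)
  have hcutlip : ∀ x y, |cut x - cut y| ≤ (r : ℝ)⁻¹ * ‖x - y‖ := fun x y ↦ by
    have h1 : |cut x - cut y| ≤
        |(2 - (r : ℝ)⁻¹ * ‖x - x₀‖) - (2 - (r : ℝ)⁻¹ * ‖y - x₀‖)| :=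
      abs_max_min_sub_le _ _
    refine h1.trans ?_
    rw [sub_sub_sub_cancel_left, ← mul_sub, abs_mul, abs_of_nonneg (by positivity : 0 ≤ (r : ℝ)⁻¹)]
    refine mul_le_mul_of_nonneg_left ((abs_norm_sub_norm_le _ _).trans_eq ?_) (by positivity)
    rw [sub_sub_sub_cancel_right, norm_sub_rev]
  set g : E → E := fun x ↦ cut x • f x with hg
  set L : NNReal := K * (2 * r) + C with hL
  have hgL : ∀ x, ‖g x‖ ≤ L := fun x ↦ by
    rw [hg, norm_smul, Real.norm_of_nonneg (hcut0 x)]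
    by_cases hx : ‖x - x₀‖ ≤ 2 * r
    · calc cut x * ‖f x‖ ≤ 1 * (K * (2 * r) + C) := by
            refine mul_le_mul (hcut1 x) ((hgrow x).trans ?_) (norm_nonneg _) zero_le_one
            gcongr
        _ = L := by rw [hL]; push_cast; ring
    · have h2 : 2 ≤ (r : ℝ)⁻¹ * ‖x - x₀‖ := by
        rw [inv_mul_eq_div, le_div_iff₀ (by positivity)]
        exact (not_le.1 hx).le
      have h3 : cut x = 0 := max_eq_left ((min_le_right _ _).trans (by linarith))
      rw [h3, zero_mul]
      positivity
  have hgnorm : ∀ x, ‖g x‖ ≤ K * ‖x - x₀‖ + C := fun x ↦ by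
    rw [hg, norm_smul, Real.norm_of_nonneg (hcut0 x)]
    exact (mul_le_of_le_one_left (norm_nonneg _) (hcut1 x)).trans (hgrow x)
  set T' : NNReal := Real.toNNReal T + 1 with hT'
  have hT'T : (T' : ℝ) = T + 1 := by rw [hT']; push_cast; rw [Real.coe_toNNReal _ hT.le]
  set a : NNReal := L * T' with ha
  set K' : NNReal := K + r⁻¹ * (K * a + C) with hK'
  have hglip : LipschitzOnWith K' g (Metric.closedBall x₀ a) := by
    refine LipschitzOnWith.of_dist_le_mul fun x _ y hy ↦ ?_
    rw [mem_closedBall_iff_norm] at hy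
    rw [dist_eq_norm, dist_eq_norm,
      show g x - g y = cut x • (f x - f y) + (cut x - cut y) • f y by simp only [hg]; module]
    refine (norm_add_le _ _).trans ?_
    rw [norm_smul, norm_smul, Real.norm_of_nonneg (hcut0 x), Real.norm_eq_abs]
    have h1 : cut x * ‖f x - f y‖ ≤ 1 * (K * ‖x - y‖) :=
      mul_le_mul (hcut1 x) (hf.norm_sub_le x y) (norm_nonneg _) zero_le_one
    have h2 : |cut x - cut y| * ‖f y‖ ≤ ((r : ℝ)⁻¹ * ‖x - y‖) * (K * a + C) := by
      refine mul_le_mul (hcutlip x y) ((hgrow y).trans ?_) (norm_nonneg _) (by positivity)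
      gcongr
    calc _ ≤ _ := add_le_add h1 h2
      _ = K' * ‖x - y‖ := by rw [hK']; push_cast; ring
  have hpl : IsPicardLindelof (fun _ ↦ g) (tmin := -1) (tmax := T + 1)
      ⟨0, by constructor <;> linarith⟩ x₀ a 0 L K' := by
    refine .of_time_independent (fun x _ ↦ hgL x) hglip ?_
    rw [ha, max_eq_left (by simp; linarith)]
    push_cast
    rw [hT'T]
    simp
  obtain ⟨u, hu0, hu⟩ := hpl.exists_eq_forall_mem_Icc_hasDerivWithinAt₀
  have hd : ∀ t ∈ Icc 0 T, HasDerivAt u (g (u t)) t := fun t ht ↦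
    (hu t ⟨by linarith [ht.1], by linarith [ht.2]⟩).hasDerivAt
      (Icc_mem_nhds (by linarith [ht.1]) (by linarith [ht.2]))
  simp only at hu0
  refine ⟨u, hu0, fun t ht ↦ ?_⟩
  -- The growth bound of the truncated field does not involve `r`, so the solution never leaves the
  -- ball of radius `r`, where the cutoff is inactive.
  have hgw := norm_le_gronwallBound_of_norm_deriv_right_le (f := fun t ↦ u t - x₀)
    (f' := fun t ↦ g (u t)) (δ := 0) (K := K) (ε := C) (a := 0) (b := T)
    (fun s hs ↦ ((hd s hs).sub_const x₀).continuousAt.continuousWithinAt)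
    (fun s hs ↦ ((hd s (Ico_subset_Icc_self hs)).sub_const x₀).hasDerivWithinAt)
    (by simp [hu0]) (fun s _ ↦ hgnorm _) t ht
  have hur : ‖u t - x₀‖ ≤ r := by
    refine hgw.trans (le_trans ?_ hr)
    exact gronwallBound_mono le_rfl C.2 K.2 (by linarith [ht.2])
  have hcut_one : cut (u t) = 1 := by
    have h1 : (r : ℝ)⁻¹ * ‖u t - x₀‖ ≤ 1 := by
      rw [inv_mul_eq_div, div_le_one (by positivity)]
      exact hur
    simp only [hcut]
    rw [min_eq_left (by linarith), max_eq_right zero_le_one]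
  simpa only [hg, hcut_one, one_smul] using hd t ht

/-- Gronwall's inequality for the squared norm of a curve in an inner product space. -/
theorem norm_sq_le_gronwallBound {E : Type*} [NormedAddCommGroup E] [InnerProductSpace ℝ E]
    {w w' : ℝ → E} {T K ε : ℝ} (hw : ∀ t ∈ Icc 0 T, HasDerivAt w (w' t) t)
    (hbound : ∀ t ∈ Icc 0 T, 2 * inner ℝ (w t) (w' t) ≤ K * ‖w t‖ ^ 2 + ε) :
    ∀ t ∈ Icc 0 T, ‖w t‖ ^ 2 ≤ gronwallBound (‖w 0‖ ^ 2) K ε t := by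
  have h := le_gronwallBound_of_liminf_deriv_right_le (f := fun t ↦ ‖w t‖ ^ 2)
    (f' := fun t ↦ 2 * inner ℝ (w t) (w' t)) (δ := ‖w 0‖ ^ 2) (K := K) (ε := ε) (a := 0) (b := T)
    (fun s hs ↦ (hw s hs).norm_sq.continuousAt.continuousWithinAt)
    (fun s hs r hr ↦ (hw s (Ico_subset_Icc_self hs)).norm_sq.hasDerivWithinAt.liminf_right_slope_le
      hr) le_rfl (fun s hs ↦ hbound s (Ico_subset_Icc_self hs))
  simpa using h

/-- Along a trajectory of a one-sided Lipschitz vector field the speed grows at most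
exponentially. -/
theorem norm_sq_speed_le {E : Type*} [NormedAddCommGroup E] [InnerProductSpace ℝ E]
    {f : E → E} {K : ℝ} (hK : 0 ≤ K)
    (hf : ∀ x y, 2 * inner ℝ (x - y) (f x - f y) ≤ K * ‖x - y‖ ^ 2) {T : ℝ} (hT : 0 < T)
    {u : ℝ → E} (hu : ∀ t ∈ Icc 0 T, HasDerivAt u (f (u t)) t) {t : ℝ} (ht : t ∈ Ico 0 T) :
    ‖f (u t)‖ ^ 2 ≤ ‖f (u 0)‖ ^ 2 * Real.exp (K * T) := by
  -- A time shift of a trajectory is again a trajectory; Gronwall compares the two, and letting `h →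
  -- 0+` turns difference quotients into speeds.
  have hle : ∀ h ∈ Ioc 0 (T - t),
      ‖h⁻¹ • (u (t + h) - u t)‖ ^ 2 ≤ ‖h⁻¹ • (u (0 + h) - u 0)‖ ^ 2 * Real.exp (K * T) := by
    intro h hh
    have hg := norm_sq_le_gronwallBound (w := fun s ↦ u (s + h) - u s)
      (w' := fun s ↦ f (u (s + h)) - f (u s)) (T := T - h) (K := K) (ε := 0)
      (fun s hs ↦ ((hu (s + h) ⟨by linarith [hs.1, hh.1], by linarith [hs.2]⟩).comp_add_const
        s h).sub (hu s ⟨hs.1, by linarith [hs.2, hh.1]⟩))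
      (fun s _ ↦ by rw [add_zero]; exact hf _ _) t ⟨ht.1, by linarith [hh.2]⟩
    rw [gronwallBound_ε0] at hg
    have h1 : Real.exp (K * t) ≤ Real.exp (K * T) :=
      Real.exp_le_exp.2 (mul_le_mul_of_nonneg_left ht.2.le hK)
    rw [norm_smul, norm_smul, mul_pow, mul_pow, mul_assoc]
    refine mul_le_mul_of_nonneg_left (hg.trans ?_) (by positivity)
    exact mul_le_mul_of_nonneg_left h1 (by positivity)
  have hlim : ∀ s ∈ Icc 0 T, Tendsto (fun h ↦ ‖h⁻¹ • (u (s + h) - u s)‖ ^ 2) (𝓝[>] 0)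
      (𝓝 (‖f (u s)‖ ^ 2)) := fun s hs ↦
    ((hasDerivAt_iff_tendsto_slope_zero.1 (hu s hs)).mono_left
      (nhdsWithin_mono 0 fun x (hx : 0 < x) ↦ hx.ne')).norm.pow 2
  refine le_of_tendsto_of_tendsto (hlim t (Ico_subset_Icc_self ht))
    ((hlim 0 ⟨le_rfl, hT.le⟩).mul_const _) ?_
  filter_upwards [Ioc_mem_nhdsGT (sub_pos.2 ht.2)] with h hh
  exact hle h hh

/-! ### Weak limits and primitives -/

/-- A bounded sequence in a Hilbert space has a point that represents all limits of its
coordinates. -/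
theorem exists_inner_eq_of_tendsto {E : Type*} [NormedAddCommGroup E] [InnerProductSpace ℝ E]
    [CompleteSpace E] (v : ℕ → E) {R : ℝ} (hv : ∀ n, ‖v n‖ ≤ R) :
    ∃ g, ∀ (w : E) (l : ℝ), Tendsto (fun n ↦ inner ℝ w (v n)) atTop (𝓝 l) →
      inner ℝ w g = l := by
  -- A point common to the closed convex hulls of all tails: every half-space condition that
  -- eventually holds along the sequence passes to it.
  obtain ⟨g, hg⟩ := nonempty_iInter_of_closed_convex
    (fun n : ℕ ↦ closure (convexHull ℝ (v '' Ici n))) (fun n ↦ isClosed_closure)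
    (fun n ↦ (convex_convexHull ℝ _).closure) 0
    (Metric.isBounded_closedBall.subset (closure_minimal (convexHull_min
      (image_subset_iff.2 fun n _ ↦ mem_closedBall_zero_iff.2 (hv n)) (convex_closedBall 0 R))
      Metric.isClosed_closedBall))
    (fun F ↦ ⟨v (F.sup id), mem_iInter₂.2 fun n hn ↦ subset_closure (subset_convexHull ℝ _
      ⟨_, Finset.le_sup (f := id) hn, rfl⟩)⟩)
  refine ⟨g, fun w l hl ↦ eq_of_forall_dist_le fun ε hε ↦ ?_⟩
  obtain ⟨N, hN⟩ := Metric.tendsto_atTop.1 hl ε hε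
  have hsub : closure (convexHull ℝ (v '' Ici N)) ⊆ innerSL ℝ w ⁻¹' Metric.closedBall l ε :=
    closure_minimal (convexHull_min (image_subset_iff.2 fun n hn ↦ (hN n hn).le)
      ((convex_closedBall l ε).linear_preimage (innerSL ℝ w).toLinearMap))
      (Metric.isClosed_closedBall.preimage (innerSL ℝ w).continuous)
  exact hsub (mem_iInter.1 hg N)

/-- A pointwise limit of curves with uniformly bounded speed is a primitive of an `L²` function. -/
theorem exists_memLp_eq_add_integral {E : Type*} [NormedAddCommGroup E] [InnerProductSpace ℝ E]
    [CompleteSpace E] {T M : ℝ} (hT : 0 < T) {u d : ℕ → ℝ → E} {u' : ℝ → E}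
    (hu : ∀ n, ∀ t ∈ Icc 0 T, HasDerivAt (u n) (d n t) t)
    (hcont : ∀ n, ContinuousOn (d n) (Icc 0 T)) (hM : ∀ n, ∀ t ∈ Icc 0 T, ‖d n t‖ ≤ M)
    (hlim : ∀ t ∈ Icc 0 T, Tendsto (fun n ↦ u n t) atTop (𝓝 (u' t))) :
    ∃ g : ℝ → E, MemLp g 2 (volume.restrict (Icc 0 T)) ∧
      ∀ t ∈ Icc 0 T, u' t = u' 0 + ∫ s in (0)..t, g s := by
  set μ := (volume.restrict (Icc 0 T) : Measure ℝ) with hμ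
  have hmem : ∀ n, MemLp (d n) 2 μ := fun n ↦
    MemLp.of_bound ((hcont n).aestronglyMeasurable measurableSet_Icc) M
      ((ae_restrict_iff' measurableSet_Icc).2 (ae_of_all _ (hM n)))
  set v : ℕ → Lp E 2 μ := fun n ↦ (hmem n).toLp (d n) with hv
  have hvb : ∀ n, ‖v n‖ ≤ (measureUnivNNReal μ : ℝ) ^ (2 : ENNReal).toReal⁻¹ * M := fun n ↦ by
    refine Lp.norm_le_of_ae_bound ((norm_nonneg _).trans (hM 0 0 ⟨le_rfl, hT.le⟩)) ?_
    filter_upwards [(hmem n).coeFn_toLp, (ae_restrict_iff' measurableSet_Icc).2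
      (ae_of_all volume (hM n))] with t h1 h2
    rw [h1]
    exact h2
  obtain ⟨g, hg⟩ := exists_inner_eq_of_tendsto v hvb
  refine ⟨g, Lp.memLp g, fun t ht ↦ ?_⟩
  have hint : ∀ f : ℝ → E, ∫ s in Ioc 0 t, f s ∂μ = ∫ s in (0)..t, f s := fun f ↦ by
    rw [intervalIntegral.integral_of_le ht.1, hμ, Measure.restrict_restrict measurableSet_Ioc,
      inter_eq_left.2 (Ioc_subset_Icc_self.trans (Icc_subset_Icc_right ht.2))]
  have hfin : μ (Ioc 0 t) ≠ ⊤ := measure_ne_top _ _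
  rw [← sub_eq_iff_eq_add']
  refine ext_inner_left ℝ fun c ↦ ?_
  -- Testing against `c` times the indicator of `(0, t]` turns the pairing into an increment of the
  -- curve, whose limit is known.
  have h := hg (indicatorConstLp 2 measurableSet_Ioc hfin c) (inner ℝ c (u' t - u' 0)) ?_
  · rw [← h, L2.inner_indicatorConstLp_eq_inner_setIntegral, hint]
  · have hsub : Icc 0 t ⊆ Icc 0 T := Icc_subset_Icc_right ht.2
    have heq : ∀ n, inner ℝ (indicatorConstLp 2 measurableSet_Ioc hfin c) (v n)
        = inner ℝ c (u n t - u n 0) := fun n ↦ by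
      rw [L2.inner_indicatorConstLp_eq_inner_setIntegral]
      congr 1
      rw [setIntegral_congr_ae measurableSet_Ioc ((hmem n).coeFn_toLp.mono fun _ h _ ↦ h), hint]
      refine intervalIntegral.integral_eq_sub_of_hasDerivAt (fun s hs ↦ ?_) ?_
      · rw [uIcc_of_le ht.1] at hs
        exact hu n s (hsub hs)
      · exact ((hcont n).mono (by rw [uIcc_of_le ht.1]; exact hsub)).intervalIntegrable
    simp only [heq]
    exact tendsto_const_nhds.inner ((hlim t ht).sub (hlim 0 ⟨le_rfl, hT.le⟩))

/-! ### Evolution by a maximal monotone relation -/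

/-- A monotone relation whose resolvent at parameter one is everywhere defined is maximal. -/
theorem rel_of_forall_inner_nonneg {G : H → H → Prop}
    (hrange : ∀ y, ∃ x, G x (y - x)) {x p : H}
    (h : ∀ y q, G y q → 0 ≤ inner ℝ (p - q) (x - y)) : G x p := by
  obtain ⟨y, hy⟩ := hrange (x + p)
  have h1 := h y _ hy
  have h2 : p - (x + p - y) = -(x - y) := by abel
  rw [h2, inner_neg_left, real_inner_self_eq_norm_sq] at h1
  have h3 : x - y = 0 := by
    rw [← norm_eq_zero]
    nlinarith [norm_nonneg (x - y)]
  obtain rfl : x = y := sub_eq_zero.1 h3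
  simpa using hy

/-- Regularized evolution equations: solutions of the Yosida approximations, with bounds
independent of the approximation parameter. -/
theorem exists_yosida_evolution [CompleteSpace H] {G : H → H → Prop}
    (hmono : ∀ x p y q, G x p → G y q → 0 ≤ inner ℝ (p - q) (x - y))
    (hrange : ∀ lam : ℝ, 0 < lam → ∀ y, ∃ x, G x (lam⁻¹ • (y - x)))
    {x₀ p₀ : H} (h₀ : G x₀ p₀) (ω : ℝ) {T : ℝ} (hT : 0 < T) :
    ∃ M : ℝ, ∀ lam : ℝ, 0 < lam → ∃ u b : ℝ → H, u 0 = x₀ ∧ ContinuousOn b (Icc 0 T) ∧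
      ∀ t ∈ Icc 0 T, HasDerivAt u (-b t - ω • u t) t ∧ G (u t - lam • b t) (b t) ∧
        ‖-b t - ω • u t‖ ≤ M ∧ ‖b t‖ ≤ M ∧ ‖u t‖ ≤ M := by
  set C := ‖p₀‖ + |ω| * ‖x₀‖ with hC
  have hC0 : 0 ≤ C := by positivity
  set κ := 2 * |ω| with hκ
  have hκ0 : 0 ≤ κ := by positivity
  set V := C * Real.exp (κ * (T + 1)) with hV
  have hV0 : 0 ≤ V := by positivity
  set R := ‖x₀‖ + V * T with hR
  have hR0 : 0 ≤ R := by positivity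
  refine ⟨V + |ω| * R + R, fun lam hlam ↦ ?_⟩
  choose J hJ using hrange lam hlam
  set B : H → H := fun z ↦ lam⁻¹ • (z - J z) with hB
  have hJB : ∀ z, J z = z - lam • B z := fun z ↦ by
    rw [hB, smul_inv_smul₀ hlam.ne', sub_sub_cancel]
  have hBmono : ∀ x y, lam * ‖B x - B y‖ ^ 2 ≤ inner ℝ (x - y) (B x - B y) := fun x y ↦ by
    have h := hmono _ _ _ _ (hJ x) (hJ y)
    change 0 ≤ inner ℝ (B x - B y) (J x - J y) at h
    rw [hJB x, hJB y, show x - lam • B x - (y - lam • B y) = (x - y) - lam • (B x - B y) by module,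
      inner_sub_right, inner_smul_right, real_inner_self_eq_norm_sq, real_inner_comm] at h
    linarith
  have hBlip : ∀ x y, ‖B x - B y‖ ≤ lam⁻¹ * ‖x - y‖ := fun x y ↦ by
    rw [inv_mul_eq_div, le_div_iff₀ hlam]
    have h := (hBmono x y).trans (real_inner_le_norm _ _)
    rcases (norm_nonneg (B x - B y)).eq_or_lt with h0 | h0
    · rw [← h0, zero_mul]
      positivity
    · nlinarith
  -- The source of uniformity in `lam`: the initial speed is controlled by one element of the graph
  -- over `x₀`.
  have hB₀ : ‖B x₀‖ ≤ ‖p₀‖ := by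
    have h := hmono _ _ _ _ h₀ (hJ x₀)
    change 0 ≤ inner ℝ (p₀ - B x₀) (x₀ - J x₀) at h
    rw [hJB, sub_sub_cancel, inner_smul_right, inner_sub_left, real_inner_self_eq_norm_sq] at h
    have h1 := nonneg_of_mul_nonneg_right h hlam
    have h2 := real_inner_le_norm p₀ (B x₀)
    rcases (norm_nonneg (B x₀)).eq_or_lt with h0 | h0
    · rw [← h0]
      positivity
    · nlinarith
  set f : H → H := fun z ↦ -B z - ω • z with hf
  have hflip : LipschitzWith (Real.toNNReal (lam⁻¹ + |ω|)) f := by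
    refine LipschitzWith.of_dist_le_mul fun x y ↦ ?_
    rw [Real.coe_toNNReal _ (by positivity), dist_eq_norm, dist_eq_norm,
      show f x - f y = -(B x - B y) - ω • (x - y) by simp only [hf]; module, add_mul]
    refine (norm_sub_le _ _).trans (add_le_add ?_ ?_)
    · rw [norm_neg]
      exact hBlip x y
    · rw [norm_smul, Real.norm_eq_abs]
  have hfone : ∀ x y, 2 * inner ℝ (x - y) (f x - f y) ≤ κ * ‖x - y‖ ^ 2 := fun x y ↦ by
    rw [show f x - f y = -(B x - B y) - ω • (x - y) by simp only [hf]; module, inner_sub_right,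
      inner_neg_right, inner_smul_right, real_inner_self_eq_norm_sq]
    have h1 := hBmono x y
    have h2 : 0 ≤ lam * ‖B x - B y‖ ^ 2 := by positivity
    have h3 := mul_le_mul_of_nonneg_right (neg_abs_le ω) (sq_nonneg ‖x - y‖)
    rw [hκ]
    linarith
  -- The speed estimate excludes the right endpoint, so the solution is run up to `T + 1` to include
  -- `t = T`.
  obtain ⟨u, hu0, hu⟩ := exists_hasDerivAt_of_lipschitzWith hflip x₀ (T := T + 1) (by linarith)
  have hsub : Icc 0 T ⊆ Icc 0 (T + 1) := Icc_subset_Icc_right (by linarith)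
  have hf₀ : ‖f x₀‖ ≤ C := by
    refine (norm_sub_le _ _).trans ?_
    rw [norm_neg, norm_smul ω, Real.norm_eq_abs]
    linarith
  have hspeed : ∀ t ∈ Icc 0 T, ‖f (u t)‖ ≤ V := fun t ht ↦ by
    have h := norm_sq_speed_le hκ0 hfone (by linarith) hu (t := t)
      ⟨ht.1, by linarith [ht.2]⟩
    rw [hu0] at h
    refine le_of_sq_le_sq (h.trans ?_) hV0
    rw [hV, mul_pow]
    have he : 1 ≤ Real.exp (κ * (T + 1)) := Real.one_le_exp (by positivity)
    refine mul_le_mul (pow_le_pow_left₀ (norm_nonneg _) hf₀ 2) ?_ (by positivity) (by positivity)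
    nlinarith
  have hbd : ∀ t ∈ Icc 0 T, ‖u t‖ ≤ R := fun t ht ↦ by
    have h := (convex_Icc 0 T).norm_image_sub_le_of_norm_hasDerivWithin_le
      (fun s hs ↦ (hu s (hsub hs)).hasDerivWithinAt) hspeed ⟨le_rfl, hT.le⟩ ht
    rw [hu0, sub_zero, Real.norm_of_nonneg ht.1] at h
    have h1 := norm_le_norm_add_norm_sub' (u t) x₀
    have h2 := mul_le_mul_of_nonneg_left ht.2 hV0
    linarith
  have hBcont : Continuous B :=
    (LipschitzWith.of_dist_le_mul (K := Real.toNNReal lam⁻¹) fun x y ↦ by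
      rw [Real.coe_toNNReal _ (by positivity), dist_eq_norm, dist_eq_norm]
      exact hBlip x y).continuous
  refine ⟨u, fun t ↦ B (u t), hu0, hBcont.comp_continuousOn
    fun t ht ↦ (hu t (hsub ht)).continuousAt.continuousWithinAt, fun t ht ↦
    ⟨hu t (hsub ht), ?_, ?_, ?_, ?_⟩⟩
  · rw [← hJB]
    exact hJ (u t)
  · have h1 : 0 ≤ |ω| * R := by positivity
    exact (hspeed t ht).trans (by linarith)
  · have h1 : B (u t) = -(f (u t) + ω • u t) := by simp only [hf]; module
    have h2 := norm_add_le (f (u t)) (ω • u t)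
    rw [norm_smul, Real.norm_eq_abs] at h2
    have h3 := mul_le_mul_of_nonneg_left (hbd t ht) (abs_nonneg ω)
    change ‖B (u t)‖ ≤ _
    rw [h1, norm_neg]
    linarith [hspeed t ht]
  · have h1 : 0 ≤ |ω| * R := by positivity
    linarith [hbd t ht]

/-- Two regularized evolutions differ by at most the square root of the sum of the parameters. -/
theorem norm_sq_sub_yosida_le {G : H → H → Prop}
    (hmono : ∀ x p y q, G x p → G y q → 0 ≤ inner ℝ (p - q) (x - y)) {ω T M lam mu : ℝ}
    (hlam : 0 < lam) (hmu : 0 < mu) {u b v c : ℝ → H} (h0 : u 0 = v 0)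
    (hu : ∀ t ∈ Icc 0 T, HasDerivAt u (-b t - ω • u t) t ∧ G (u t - lam • b t) (b t) ∧ ‖b t‖ ≤ M)
    (hv : ∀ t ∈ Icc 0 T, HasDerivAt v (-c t - ω • v t) t ∧ G (v t - mu • c t) (c t) ∧ ‖c t‖ ≤ M) :
    ∀ t ∈ Icc 0 T, ‖u t - v t‖ ^ 2 ≤
      4 * M ^ 2 * Real.exp ((2 * |ω| + 1) * T) * (lam + mu) := by
  intro t ht
  -- The `+ 1` gives `ε / κ ≤ ε` even when `ω = 0`.
  set κ := 2 * |ω| + 1 with hκ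
  have hκ1 : 1 ≤ κ := by linarith [abs_nonneg ω]
  set ε := 4 * M ^ 2 * (lam + mu) with hε
  have hε0 : 0 ≤ ε := by positivity
  have h := norm_sq_le_gronwallBound (w := fun t ↦ u t - v t) (K := κ) (ε := ε)
    (fun s hs ↦ (hu s hs).1.sub (hv s hs).1) (fun s hs ↦ ?_) t ht
  · simp only [h0, sub_self, norm_zero] at h
    refine h.trans ?_
    rw [gronwallBound_of_K_ne_0 (by linarith)]
    have h1 : Real.exp (κ * t) ≤ Real.exp (κ * T) :=
      Real.exp_le_exp.2 (mul_le_mul_of_nonneg_left ht.2 (by linarith))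
    have h2 : ε / κ ≤ ε := div_le_self hε0 hκ1
    have h3 : 1 ≤ Real.exp (κ * t) := Real.one_le_exp (mul_nonneg (by linarith) ht.1)
    calc _ = ε / κ * (Real.exp (κ * t) - 1) := by ring
      _ ≤ ε * Real.exp (κ * T) := mul_le_mul h2 (by linarith) (by linarith) hε0
      _ = _ := by rw [hε]; ring
  · obtain ⟨-, hG, hb⟩ := hu s hs
    obtain ⟨-, hG', hc⟩ := hv s hs
    have hM : 0 ≤ M := (norm_nonneg _).trans hb
    -- Monotonicity holds at the resolvent points, not at `u s` and `v s`; the displacement `lam • b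
    -- s - mu • c s` produces the term `ε`.
    have h1 := hmono _ _ _ _ hG hG'
    rw [show u s - lam • b s - (v s - mu • c s) = (u s - v s) - (lam • b s - mu • c s) by module,
      inner_sub_right, real_inner_comm] at h1
    have h2 : ‖b s - c s‖ ≤ 2 * M := (norm_sub_le _ _).trans (by linarith)
    have h3 : ‖lam • b s - mu • c s‖ ≤ (lam + mu) * M := by
      refine (norm_sub_le _ _).trans ?_
      rw [norm_smul, norm_smul, Real.norm_of_nonneg hlam.le, Real.norm_of_nonneg hmu.le]
      nlinarith
    have h4 : -(inner ℝ (b s - c s) (lam • b s - mu • c s)) ≤ 2 * M * ((lam + mu) * M) := by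
      refine (neg_le_abs _).trans ((abs_real_inner_le_norm _ _).trans ?_)
      exact mul_le_mul h2 h3 (norm_nonneg _) (by positivity)
    have h5 := mul_le_mul_of_nonneg_right (neg_abs_le ω) (sq_nonneg ‖u s - v s‖)
    rw [show -b s - ω • u s - (-c s - ω • v s) = -(b s - c s) - ω • (u s - v s) by module,
      inner_sub_right, inner_neg_right, inner_smul_right, real_inner_self_eq_norm_sq, hκ, hε]
    nlinarith [sq_nonneg ‖u s - v s‖]

/-- A regularized evolution satisfies a one-step dissipation inequality against every
element of the graph of the relation. -/
theorem norm_sq_sub_norm_sq_le_of_yosida {G : H → H → Prop}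
    (hmono : ∀ x p y q, G x p → G y q → 0 ≤ inner ℝ (p - q) (x - y)) {ω T M lam : ℝ}
    (hlam : 0 < lam) {u b : ℝ → H}
    (hu : ∀ t ∈ Icc 0 T, HasDerivAt u (-b t - ω • u t) t ∧ G (u t - lam • b t) (b t) ∧
      ‖-b t - ω • u t‖ ≤ M ∧ ‖b t‖ ≤ M ∧ ‖u t‖ ≤ M)
    {y q : H} (hG : G y q) {s t : ℝ} (hs : 0 ≤ s) (hst : s ≤ t) (ht : t ≤ T) :
    ‖u t - y‖ ^ 2 - ‖u s - y‖ ^ 2 ≤ 2 * (-inner ℝ (u s - y) (q + ω • u s) + lam * (‖q‖ * M)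
      + (‖q‖ + |ω| * (2 * M + ‖y‖)) * M * (t - s)) * (t - s) := by
  have hsub : Icc s t ⊆ Icc 0 T := Icc_subset_Icc hs ht
  have hM : 0 ≤ M := (norm_nonneg _).trans (hu s ⟨hs, hst.trans ht⟩).2.2.2.2
  have hder : ∀ r ∈ Icc s t, HasDerivAt (fun r ↦ ‖u r - y‖ ^ 2)
      (2 * inner ℝ (u r - y) (-b r - ω • u r)) r := fun r hr ↦
    ((hu r (hsub hr)).1.sub_const y).norm_sq
  refine (convex_Icc s t).image_sub_le_mul_sub_of_deriv_le
    (f := fun r ↦ ‖u r - y‖ ^ 2)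
    (fun r hr ↦ (hder r hr).continuousAt.continuousWithinAt)
    (fun r hr ↦ (hder r (interior_subset hr)).differentiableAt.differentiableWithinAt)
    (fun r hr ↦ ?_) s ⟨le_rfl, hst⟩ t ⟨hst, le_rfl⟩ hst
  have hr' := interior_subset hr
  rw [(hder r hr').deriv]
  refine mul_le_mul_of_nonneg_left ?_ zero_le_two
  obtain ⟨-, hGr, -, hbr, hur⟩ := hu r (hsub hr')
  have hus := (hu s ⟨hs, hst.trans ht⟩).2.2.2.2
  have hmon := hmono _ _ _ _ hGr hG
  rw [sub_right_comm, inner_sub_right, inner_smul_right, inner_sub_left (b r) q (u r - y),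
    inner_sub_left (b r) q (b r), real_inner_self_eq_norm_sq, real_inner_comm _ (b r),
    real_inner_comm _ q] at hmon
  have h1 : inner ℝ q (b r) ≤ ‖q‖ * M :=
    (real_inner_le_norm _ _).trans (mul_le_mul_of_nonneg_left hbr (norm_nonneg _))
  have h2 : lam * (inner ℝ q (b r) - ‖b r‖ ^ 2) ≤ lam * (‖q‖ * M) :=
    mul_le_mul_of_nonneg_left (by nlinarith [sq_nonneg ‖b r‖]) hlam.le
  have hdist : ‖u r - u s‖ ≤ M * (t - s) := by
    have h := (convex_Icc s t).norm_image_sub_le_of_norm_hasDerivWithin_le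
      (fun z hz ↦ (hu z (hsub hz)).1.hasDerivWithinAt) (fun z hz ↦ (hu z (hsub hz)).2.2.1)
      ⟨le_rfl, hst⟩ hr'
    rw [Real.norm_of_nonneg (sub_nonneg.2 hr'.1)] at h
    exact h.trans (mul_le_mul_of_nonneg_left (by linarith [hr'.2]) hM)
  -- Freezing the right-hand side at time `s` costs `O(t - s)`, since the speed is at most `M`.
  have h3 : inner ℝ (u s - y) (q + ω • u s) - inner ℝ (u r - y) (q + ω • u r)
      = -inner ℝ (u r - u s) (q + ω • u r) - ω * inner ℝ (u s - y) (u r - u s) := by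
    simp only [inner_sub_left, inner_sub_right, inner_add_right, inner_smul_right]
    ring
  have h4 : -inner ℝ (u r - u s) (q + ω • u r) ≤ M * (t - s) * (‖q‖ + |ω| * M) := by
    refine (neg_le_abs _).trans ((abs_real_inner_le_norm _ _).trans ?_)
    refine mul_le_mul hdist ((norm_add_le _ _).trans ?_) (norm_nonneg _)
      (mul_nonneg hM (sub_nonneg.2 hst))
    rw [norm_smul, Real.norm_eq_abs]
    gcongr
  have h5 : -(ω * inner ℝ (u s - y) (u r - u s)) ≤ |ω| * ((M + ‖y‖) * (M * (t - s))) := by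
    refine (neg_le_abs _).trans ?_
    rw [abs_mul]
    refine mul_le_mul_of_nonneg_left ((abs_real_inner_le_norm _ _).trans ?_) (abs_nonneg _)
    exact mul_le_mul ((norm_sub_le _ _).trans (by linarith)) hdist (norm_nonneg _)
      (by positivity)
  have h6 : inner ℝ (u r - y) (-b r - ω • u r)
      = -inner ℝ (u r - y) (b r) + inner ℝ (u r - y) q - inner ℝ (u r - y) (q + ω • u r) := by
    simp only [inner_sub_right, inner_add_right, inner_neg_right]
    ring
  rw [h6]
  linarith

/-- The evolution equation governed by a maximal monotone relation perturbed by a multiple of the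
identity. -/
theorem exists_evolution_of_monotone [CompleteSpace H] {G : H → H → Prop}
    (hmono : ∀ x p y q, G x p → G y q → 0 ≤ inner ℝ (p - q) (x - y))
    (hrange : ∀ lam : ℝ, 0 < lam → ∀ y, ∃ x, G x (lam⁻¹ • (y - x)))
    {x₀ p₀ : H} (h₀ : G x₀ p₀) (ω : ℝ) {T : ℝ} (hT : 0 < T) :
    ∃ u : ℝ → H, MemPathSpace T u ∧ u 0 = x₀ ∧
      ∀ᵐ t ∂(volume.restrict (Icc 0 T)), G (u t) (-deriv u t - ω • u t) := by
  obtain ⟨M, hM⟩ := exists_yosida_evolution hmono hrange h₀ ω hT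
  set lam : ℕ → ℝ := fun n ↦ 1 / ((n : ℝ) + 1) with hlam
  have hlam0 : ∀ n, 0 < lam n := fun n ↦ by positivity
  have hlamlim : Tendsto lam atTop (𝓝 0) := tendsto_one_div_add_atTop_nhds_zero_nat
  choose u b hu0 hbcont hu using fun n ↦ hM (lam n) (hlam0 n)
  have h0mem : (0 : ℝ) ∈ Icc 0 T := ⟨le_rfl, hT.le⟩
  have hM0 : 0 ≤ M := (norm_nonneg _).trans (hu 0 0 h0mem).2.2.2.2
  have hcauchy : ∀ t ∈ Icc 0 T, CauchySeq fun n ↦ u n t := by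
    intro t ht
    set D := 4 * M ^ 2 * Real.exp ((2 * |ω| + 1) * T) with hD
    have hD0 : 0 ≤ D := by positivity
    have hDlim : Tendsto (fun n ↦ D * (lam n + lam n)) atTop (𝓝 0) := by
      simpa using (hlamlim.add hlamlim).const_mul D
    refine Metric.cauchySeq_iff'.2 fun ε hε ↦ ?_
    obtain ⟨N, hN⟩ := (hDlim.eventually_lt_const (pow_pos hε 2)).exists
    refine ⟨N, fun n hn ↦ ?_⟩
    have h := norm_sq_sub_yosida_le hmono (hlam0 n) (hlam0 N) (M := M)
      (by rw [hu0 n, hu0 N])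
      (fun s hs ↦ ⟨(hu n s hs).1, (hu n s hs).2.1, (hu n s hs).2.2.2.1⟩)
      (fun s hs ↦ ⟨(hu N s hs).1, (hu N s hs).2.1, (hu N s hs).2.2.2.1⟩) t ht
    have hle : lam n ≤ lam N := one_div_le_one_div_of_le (by positivity) (by gcongr)
    have h1 : D * (lam n + lam N) ≤ D * (lam N + lam N) := by gcongr
    rw [dist_eq_norm]
    exact lt_of_pow_lt_pow_left₀ 2 hε.le (by linarith)
  choose! v hv using fun t ht ↦ cauchySeq_tendsto_of_complete (hcauchy t ht)
  have hv0 : v 0 = x₀ := tendsto_nhds_unique (hv 0 h0mem) (by simp [hu0])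
  have hlip : LipschitzOnWith (Real.toNNReal M) v (uIcc 0 T) := by
    rw [uIcc_of_le hT.le]
    refine LipschitzOnWith.of_dist_le_mul fun s hs t ht ↦ ?_
    rw [Real.coe_toNNReal _ hM0]
    refine le_of_tendsto ((hv s hs).dist (hv t ht)) (Eventually.of_forall fun n ↦ ?_)
    rw [dist_eq_norm, dist_eq_norm]
    exact (convex_Icc 0 T).norm_image_sub_le_of_norm_hasDerivWithin_le
      (fun z hz ↦ (hu n z hz).1.hasDerivWithinAt) (fun z hz ↦ (hu n z hz).2.2.1) ht hs
  obtain ⟨g, hg, hvg⟩ := exists_memLp_eq_add_integral hT (fun n t ht ↦ (hu n t ht).1)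
    (fun n ↦ (hbcont n).neg.sub (ContinuousOn.const_smul
      (fun t ht ↦ (hu n t ht).1.continuousAt.continuousWithinAt) ω))
    (fun n t ht ↦ (hu n t ht).2.2.1) hv
  have hgint : IntervalIntegrable g volume 0 T := by
    rw [intervalIntegrable_iff_integrableOn_Icc_of_le hT.le]
    exact hg.integrable one_le_two
  have hderiv : ∀ᵐ t ∂(volume.restrict (Icc 0 T)), t ∈ Ioo 0 T ∧ HasDerivAt v (g t) t := by
    rw [ae_restrict_iff' measurableSet_Icc]
    filter_upwards [hgint.ae_hasDerivAt_integral,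
      Measure.ae_ne volume (0 : ℝ), Measure.ae_ne volume T] with t ht ht0 htT htI
    rw [uIcc_of_le hT.le] at ht
    -- The integral formula holds only on `[0, T]`, so two-sided derivatives need interior points.
    have hIoo : t ∈ Ioo 0 T := ⟨lt_of_le_of_ne htI.1 (Ne.symm ht0), lt_of_le_of_ne htI.2 htT⟩
    refine ⟨hIoo, ((ht htI 0 h0mem).const_add (v 0)).congr_of_eventuallyEq ?_⟩
    filter_upwards [Icc_mem_nhds hIoo.1 hIoo.2] with s hs
    exact hvg s hs
  refine ⟨v, ⟨hlip.absolutelyContinuousOnInterval, ?_, ?_⟩, hv0, ?_⟩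
  · filter_upwards [hderiv] with t ht
    exact ht.2.differentiableAt
  · refine (memLp_congr_ae ?_).2 hg
    filter_upwards [hderiv] with t ht
    exact ht.2.deriv
  · filter_upwards [hderiv] with s ⟨hs, hd⟩
    rw [hd.deriv]
    have hsI := Ioo_subset_Icc_self hs
    refine rel_of_forall_inner_nonneg (fun y ↦ by simpa using hrange 1 one_pos y)
      fun y q hyq ↦ ?_
    set Q := -inner ℝ (v s - y) (q + ω • v s) with hQ
    set C := (‖q‖ + |ω| * (2 * M + ‖y‖)) * M with hC
    -- The dissipation inequality involves no derivative of `u n`, so it survives pointwise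
    -- convergence; dividing by `t - s` then recovers the derivative of `v`.
    have hstep : ∀ t ∈ Ioc s T, (‖v t - y‖ ^ 2 - ‖v s - y‖ ^ 2) ≤
        2 * (Q + C * (t - s)) * (t - s) := by
      intro t ht
      have htI : t ∈ Icc 0 T := ⟨hs.1.le.trans ht.1.le, ht.2⟩
      have hlimQ : Tendsto (fun n ↦ 2 * (-inner ℝ (u n s - y) (q + ω • u n s)
          + lam n * (‖q‖ * M) + C * (t - s)) * (t - s)) atTop
          (𝓝 (2 * (Q + 0 * (‖q‖ * M) + C * (t - s)) * (t - s))) :=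
        (((((((hv s hsI).sub_const y).inner (((hv s hsI).const_smul ω).const_add q)).neg).add
          (hlamlim.mul_const _)).add_const _).const_mul 2).mul_const _
      rw [zero_mul, add_zero] at hlimQ
      refine le_of_tendsto_of_tendsto ((((hv t htI).sub_const y).norm.pow 2).sub
        (((hv s hsI).sub_const y).norm.pow 2)) hlimQ (Eventually.of_forall fun n ↦ ?_)
      exact norm_sq_sub_norm_sq_le_of_yosida hmono (hlam0 n) (hu n) hyq hs.1.le ht.1.le ht.2
    have hslope : Tendsto (slope (fun t ↦ ‖v t - y‖ ^ 2) s) (𝓝[>] s)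
        (𝓝 (2 * inner ℝ (v s - y) (g s))) :=
      (hasDerivAt_iff_tendsto_slope.1 (hd.sub_const y).norm_sq).mono_left
        (nhdsWithin_mono s fun t (ht : s < t) ↦ ht.ne')
    have hupper : Tendsto (fun t ↦ 2 * (Q + C * (t - s))) (𝓝[>] s) (𝓝 (2 * Q)) := by
      have h : Continuous fun t ↦ 2 * (Q + C * (t - s)) := by fun_prop
      have h1 := h.tendsto s
      simp only [sub_self, mul_zero, add_zero] at h1
      exact h1.mono_left nhdsWithin_le_nhds
    have hfin : 2 * inner ℝ (v s - y) (g s) ≤ 2 * Q := by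
      refine le_of_tendsto_of_tendsto hslope hupper ?_
      filter_upwards [Ioc_mem_nhdsGT hs.2] with t ht
      rw [slope_def_field, div_le_iff₀ (sub_pos.2 ht.1)]
      exact hstep t ht
    rw [real_inner_comm]
    rw [hQ] at hfin
    simp only [inner_add_right, inner_sub_right, inner_neg_right] at hfin ⊢
    linarith

end AsymFlow

/-! ### The flow of `∂φ - A` -/

theorem corollary5p1 {H : Type*} [NormedAddCommGroup H] [InnerProductSpace ℝ H] [CompleteSpace H]
    (φ : H → EReal) (hconv : AsymFlow.IsConvex φ) (hlsc : LowerSemicontinuous φ)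
    (hproper : AsymFlow.IsProper φ)
    (A : H →ₗ.[ℝ] H) (hA : AsymFlow.IsAntisymmetric A)
    (hdom : AsymFlow.effDomain φ ⊆ (A.domain : Set H))
    (x₀ : H) (hx₀ : x₀ ∈ A.domain) (hsub : (AsymFlow.subdiff φ x₀).Nonempty)
    (ω T : ℝ) (hT : 0 < T) :
    ∃ u : ℝ → H, AsymFlow.MemPathSpace T u ∧ u 0 = x₀ ∧
      ∀ᵐ t ∂(MeasureTheory.volume.restrict (Set.Icc 0 T)),
        ∃ ht : u t ∈ A.domain,
          -deriv u t + A ⟨u t, ht⟩ - ω • u t ∈ AsymFlow.subdiff φ (u t) := by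
  obtain ⟨p₀, hp₀⟩ := hsub
  have hmono : ∀ x p y q, (∃ hx : x ∈ A.domain, p + A ⟨x, hx⟩ ∈ AsymFlow.subdiff φ x) →
      (∃ hy : y ∈ A.domain, q + A ⟨y, hy⟩ ∈ AsymFlow.subdiff φ y) →
      0 ≤ inner ℝ (p - q) (x - y) := by
    rintro x p y q ⟨hx, hp⟩ ⟨hy, hq⟩
    have h1 := AsymFlow.toReal_add_inner_le hproper hp
      (AsymFlow.mem_effDomain_of_mem_subdiff hproper hq)
    have h2 := AsymFlow.toReal_add_inner_le hproper hq
      (AsymFlow.mem_effDomain_of_mem_subdiff hproper hp)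
    -- Adding the two subgradient inequalities leaves only `⟨A (x - y), x - y⟩`, which vanishes.
    have h3 := hA.inner_self (⟨x, hx⟩ - ⟨y, hy⟩)
    rw [LinearPMap.map_sub] at h3
    simp only [AddSubgroupClass.coe_sub, inner_sub_left, inner_sub_right, inner_add_left]
      at h1 h2 h3 ⊢
    linarith
  obtain ⟨u, hu, hu0, hflow⟩ := AsymFlow.exists_evolution_of_monotone
    (G := fun x p ↦ ∃ hx : x ∈ A.domain, p + A ⟨x, hx⟩ ∈ AsymFlow.subdiff φ x)
    (x₀ := x₀) (p₀ := p₀ - A ⟨x₀, hx₀⟩) hmono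
    (fun lam hlam y ↦ AsymFlow.exists_resolvent_mem_subdiff φ hconv hlsc hproper A hA hdom
      ⟨x₀, p₀, hp₀⟩ hlam y)
    ⟨hx₀, by rwa [sub_add_cancel]⟩ ω hT
  refine ⟨u, hu, hu0, ?_⟩
  filter_upwards [hflow] with t ⟨ht, hmem⟩
  exact ⟨ht, by rwa [sub_add_eq_add_sub] at hmem⟩
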